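/- Let $K\subset\mathbb{R}^n$ be a nonempty closed convex set, let $\Pi_K(x)=\operatorname{argmin}_{q\in K}\|x-q\|^2$ be the (Euclidean) projection onto $K$, let $\mu_0\in\mathbb{R}^n$ and let $h\sim\mathcal{N}(0,I_n)$. For $\sigma>0$ let $\hat\mu_K(\sigma)=\operatorname{argmin}_{\mu\in K}\|\mu_0+\sigma h-\mu\|^2=\Pi_K(\mu_0+\sigma h)$ be the constrained least squares estimator in the Gaussian sequence model and $\mathrm{err}(\sigma)=\|\hat\mu_K(\sigma)-\mu_0\|^2$. For a nonempty closed convex set $C\subset\mathbb{R}^n$ let $\delta_C=\lim_{\sigma\uparrow\infty}\mathbb{E}\|\Pi_C(\sigma h)\|^2/\sigma^2$, and for $\mu_0\in K$ let $T_K(\mu_0)=\mathrm{cl}\{\alpha(\nu-\mu_0):\alpha\ge 0,\ \nu\in K\}$ be the tangent cone of $K$ at $\mu_0$. Then the following hold. 1. Suppose $\mu_0\in K$. For every realization of $h$, the limit $\lim_{\tau\uparrow\infty}\|\Pi_K(\tau h)\|^2/\tau^2$ exists, and for all $\sigma>0$ $$\lim_{\tau\uparrow\infty}\frac{\|\Pi_K(\tau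 h)\|^2}{\tau^2}\le\frac{\mathrm{err}(\sigma)}{\sigma^2}\le\|h\|^2 .$$ The lower bound is attained in the limit: $\lim_{\sigma\uparrow\infty}\mathrm{err}(\sigma)/\sigma^2=\lim_{\tau\uparrow\infty}\|\Pi_K(\tau h)\|^2/\tau^2$. The limits defining $\delta_K$ and $\delta_{T_K(\mu_0)}$ exist (with finite expectations), and $$\lim_{\sigma\uparrow\infty}\frac{\mathbb{E}\,\mathrm{err}(\sigma)}{\sigma^2}=\delta_K,\qquad \lim_{\sigma\downarrow0}\frac{\mathbb{E}\,\mathrm{err}(\sigma)}{\sigma^2}=\delta_{T_K(\mu_0)} .$$ Consequently $\delta_K\le\delta_{T_K(\mu_0)}$. 2. For all $\sigma>0$, $\mathrm{err}(\sigma)$ is square integrable and $\mathrm{Var}(\mathrm{err}(\sigma))\le 4\sigma^2\,\mathbb{E}\,\mathrm{err}(\sigma)$. 3. For all $\sigma>0$ and all real $\lambda<1/(2\sigma^2)$, $$\mathbb{E}\exp\big(\lambda(\mathrm{err}(\sigma)-\mathbb{E}\,\mathrm{err}(\sigma))\big)\le\exp\Big(\frac{2\sigma^2\lambda^2\,\mathbb{E}\,\mathrm{err}(\sigma)}{1-2\sigma^2\lambda}\Big)$$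 (in particular the left-hand side is finite). Consequently, for all $t\ge0$, $$\mathbb{P}\Big(\big|\mathrm{err}(\sigma)-\mathbb{E}\,\mathrm{err}(\sigma)\big|\ge\sqrt{8\sigma^2\,\mathbb{E}\,\mathrm{err}(\sigma)\,t}+2\sigma^2t\Big)\le 2e^{-t}.$$ -/

import Mathlib

open MeasureTheory ProbabilityTheory Filter Topology

noncomputable section

/-- `p` minimizes `q ↦ ‖x - q‖²` over `K`. -/
def IsProjOn {n : ℕ} (K : Set (EuclideanSpace ℝ (Fin n))) (x p : EuclideanSpace ℝ (Fin n)) :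
    Prop :=
  p ∈ K ∧ ∀ q ∈ K, ‖x - p‖ ^ 2 ≤ ‖x - q‖ ^ 2

/-- The projection `Π_K(x) = argmin_{q ∈ K} ‖x - q‖²`. For nonempty closed convex `K` the minimizer
exists and is unique, see `existsUnique_isProjOn` and `convexProj_spec`. -/
def convexProj {n : ℕ} (K : Set (EuclideanSpace ℝ (Fin n))) (x : EuclideanSpace ℝ (Fin n)) :
    EuclideanSpace ℝ (Fin n) :=
  Classical.epsilon (IsProjOn K x)

theorem existsUnique_isProjOn {n : ℕ} {K : Set (EuclideanSpace ℝ (Fin n))} (hne : K.Nonempty)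
    (hcl : IsClosed K) (hcv : Convex ℝ K) (x : EuclideanSpace ℝ (Fin n)) :
    ∃! p, IsProjOn K x p := by
  obtain ⟨v, hv, hmin⟩ := exists_norm_eq_iInf_of_complete_convex hne hcl.isComplete hcv x
  have hvar := (norm_eq_iInf_iff_real_inner_le_zero hcv hv).1 hmin
  have key : ∀ q ∈ K, ‖x - v‖ ^ 2 + ‖q - v‖ ^ 2 ≤ ‖x - q‖ ^ 2 := by
    intro q hq
    have h1 := hvar q hq
    have h2 := norm_sub_sq_real (x - v) (q - v)
    rw [sub_sub_sub_cancel_right] at h2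
    linarith
  refine ⟨v, ⟨hv, fun q hq => ?_⟩, ?_⟩
  · nlinarith [key q hq, sq_nonneg ‖q - v‖]
  · rintro p ⟨hp, hpm⟩
    have h1 := key p hp
    have h2 := hpm v hv
    have h3 : ‖p - v‖ ^ 2 = 0 := le_antisymm (by linarith) (sq_nonneg _)
    exact sub_eq_zero.1 (norm_eq_zero.1 (pow_eq_zero_iff (two_ne_zero) |>.1 h3))

theorem convexProj_spec {n : ℕ} {K : Set (EuclideanSpace ℝ (Fin n))} (hne : K.Nonempty)
    (hcl : IsClosed K) (hcv : Convex ℝ K) (x : EuclideanSpace ℝ (Fin n)) :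
    IsProjOn K x (convexProj K x) :=
  Classical.epsilon_spec (existsUnique_isProjOn hne hcl hcv x).exists

/-- The constrained least squares estimator `argmin_{μ ∈ K} ‖y - μ‖²` in the Gaussian sequence
model `y = μ₀ + σ h`, as a function of the noise vector `h`. -/
def seqLSE {n : ℕ} (K : Set (EuclideanSpace ℝ (Fin n))) (μ₀ : EuclideanSpace ℝ (Fin n)) (σ : ℝ)
    (h : EuclideanSpace ℝ (Fin n)) : EuclideanSpace ℝ (Fin n) :=
  convexProj K (μ₀ + σ • h)

/-- The squared estimation error `err_{(K,μ₀)}(σ) = ‖μ̂_K(σ) - μ₀‖²`. -/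
def seqErr {n : ℕ} (K : Set (EuclideanSpace ℝ (Fin n))) (μ₀ : EuclideanSpace ℝ (Fin n)) (σ : ℝ)
    (h : EuclideanSpace ℝ (Fin n)) : ℝ :=
  ‖seqLSE K μ₀ σ h - μ₀‖ ^ 2

/-- `E ‖Π_K(σ h)‖² / σ²` for `h ∼ N(0, I_n)`. -/
def scaledProjRisk {n : ℕ} (K : Set (EuclideanSpace ℝ (Fin n))) (σ : ℝ) : ℝ :=
  (∫ x, ‖convexProj K (σ • x)‖ ^ 2 ∂(stdGaussian (EuclideanSpace ℝ (Fin n)))) / σ ^ 2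

/-- The generalized statistical dimension `δ_K = lim_{σ → ∞} E ‖Π_K(σ h)‖² / σ²`. -/
def genStatDim {n : ℕ} (K : Set (EuclideanSpace ℝ (Fin n))) : ℝ :=
  limUnder atTop (scaledProjRisk K)

/-- The tangent cone `T_K(μ₀) = cl {α (ν - μ₀) : α ≥ 0, ν ∈ K}`. -/
def tangentConeOf {n : ℕ} (K : Set (EuclideanSpace ℝ (Fin n))) (μ₀ : EuclideanSpace ℝ (Fin n)) :
    Set (EuclideanSpace ℝ (Fin n)) :=
  closure {v | ∃ α : ℝ, 0 ≤ α ∧ ∃ ν ∈ K, v = α • (ν - μ₀)}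

end

/-!
The error `err(σ)` is the square of the `|σ|`-Lipschitz function `h ↦ ‖Π_K(μ₀ + σ h) - μ₀‖`. A
one-dimensional Brunn–Minkowski inequality gives the Prékopa–Leindler inequality, whose Gaussian
version tensorizes; with one of its three functions constant and its weights degenerating it becomes
the dual transport inequality: `u x ≤ g y + ‖x - y‖² / 2` for all `x`, `y` implies
`𝔼 exp u ≤ exp (𝔼 g)`. For an `L`-Lipschitz `f`, completing the square shows that `u = λ f²` and
`g = λ f² / (1 - 2 L² λ)` are such a pair, so `f² - 𝔼 f²` is sub-gamma. The second-order
expansion of this bound at `λ = 0` bounds the variance, and Chernoff's method gives the tails.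

Translating `K` by `-μ₀` reduces the limits to `‖Π_K(σ x)‖ / σ`. By the variational inequality this
quantity decreases in `σ`, and since projections are contractions the translation does not change
its limit at `∞`. As `σ ↓ 0` it tends to `‖Π_T(x)‖` for the tangent cone `T`, because the sets
`σ⁻¹ • K` increase to a dense subset of `T`. Expectations follow by dominated convergence.
-/

open scoped ENNReal NNReal Pointwise RealInnerProductSpace

section BrunnMinkowski

theorem volume_add_le_volume_add_of_isCompact {A B : Set ℝ} (hA : IsCompact A) (hB : IsCompact B)
    (hAne : A.Nonempty) (hBne : B.Nonempty) : volume A + volume B ≤ volume (A + B) := by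
  obtain ⟨a, ha, ha_max⟩ := hA.exists_isGreatest hAne
  obtain ⟨b, hb, hb_min⟩ := hB.exists_isLeast hBne
  -- `A + b` and `a + B` lie in `A + B` and meet only at `a + b`.
  have hinter : volume ((b +ᵥ A) ∩ (a +ᵥ B)) = 0 := by
    refine measure_mono_null (t := {a + b}) ?_ (measure_singleton _)
    rintro _ ⟨⟨x, hx, rfl⟩, ⟨y, hy, hxy⟩⟩
    have hxa := ha_max hx
    have hby := hb_min hy
    simp only [vadd_eq_add, Set.mem_singleton_iff] at hxy ⊢
    linarith
  calc volume A + volume B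
      = volume (b +ᵥ A) + volume (a +ᵥ B) := by rw [measure_vadd, measure_vadd]
    _ = volume ((b +ᵥ A) ∪ (a +ᵥ B)) := by
        rw [← measure_union_add_inter _ (hB.vadd a).measurableSet, hinter, add_zero]
    _ ≤ volume (A + B) := by
        refine measure_mono (Set.union_subset ?_ ?_)
        · rintro _ ⟨x, hx, rfl⟩
          exact ⟨x, hx, b, hb, add_comm x b⟩
        · rintro _ ⟨y, hy, rfl⟩
          exact ⟨a, ha, y, hy, rfl⟩

theorem volume_add_le_volume_add {A B : Set ℝ} (hA : MeasurableSet A) (hB : MeasurableSet B)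
    (hAne : A.Nonempty) (hBne : B.Nonempty) : volume A + volume B ≤ volume (A + B) := by
  obtain ⟨a, ha⟩ := hAne
  obtain ⟨b, hb⟩ := hBne
  have hcompact : ∀ K : Set ℝ, K ⊆ A ∧ IsCompact K → ∀ L : Set ℝ, L ⊆ B ∧ IsCompact L →
      volume K + volume L ≤ volume (A + B) := by
    rintro K ⟨hKA, hK⟩ L ⟨hLB, hL⟩
    calc volume K + volume L ≤ volume (insert a K) + volume (insert b L) := by
          gcongr <;> exact Set.subset_insert _ _
      _ ≤ volume (insert a K + insert b L) :=
          volume_add_le_volume_add_of_isCompact (hK.insert a) (hL.insert b)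
            (Set.insert_nonempty _ _) (Set.insert_nonempty _ _)
      _ ≤ volume (A + B) :=
          measure_mono (Set.add_subset_add (Set.insert_subset ha hKA) (Set.insert_subset hb hLB))
  rw [hA.measure_eq_iSup_isCompact, hB.measure_eq_iSup_isCompact]
  simpa only [iSup_and] using ENNReal.biSup_add_biSup_le' (p := fun K => K ⊆ A ∧ IsCompact K)
    (q := fun L => L ⊆ B ∧ IsCompact L) ⟨∅, by simp⟩ ⟨∅, by simp⟩ hcompact

theorem ofReal_mul_volume_add_le_volume_smul_add_smul {A B : Set ℝ} {t s : ℝ} (ht : 0 < t)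
    (hs : 0 < s) (hA : MeasurableSet A) (hB : MeasurableSet B) (hAne : A.Nonempty)
    (hBne : B.Nonempty) :
    ENNReal.ofReal t * volume A + ENNReal.ofReal s * volume B ≤ volume (t • A + s • B) := by
  simpa [Measure.addHaar_smul, abs_of_pos ht, abs_of_pos hs] using
    volume_add_le_volume_add (hA.const_smul₀ t) (hB.const_smul₀ s) hAne.smul_set hBne.smul_set

end BrunnMinkowski

section PrekopaLeindler

theorem lintegral_eq_setLIntegral_measure_ofReal_lt {α : Type*} [MeasurableSpace α]
    {μ : Measure α} {f : α → ℝ≥0∞} (hf : Measurable f) (hf1 : ∀ x, f x ≤ 1) :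
    ∫⁻ x, f x ∂μ = ∫⁻ r in Set.Ioi (0 : ℝ), μ {x | ENNReal.ofReal r < f x} := by
  have hfin : ∀ x, f x ≠ ∞ := fun x => ne_top_of_le_ne_top ENNReal.one_ne_top (hf1 x)
  have hcake := lintegral_eq_lintegral_meas_lt μ (f := fun x => (f x).toReal)
    (ae_of_all _ fun x => ENNReal.toReal_nonneg) hf.ennreal_toReal.aemeasurable
  simp only [ENNReal.ofReal_toReal (hfin _)] at hcake
  rw [hcake]
  refine setLIntegral_congr_fun measurableSet_Ioi fun r hr => ?_
  simp only [ENNReal.ofReal_lt_iff_lt_toReal (Set.mem_Ioi.1 hr).le (hfin _)]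

theorem lintegral_eq_iSup_lintegral_min_natCast {α : Type*} [MeasurableSpace α] {μ : Measure α}
    {f : α → ℝ≥0∞} (hf : Measurable f) :
    ∫⁻ x, f x ∂μ = ⨆ n : ℕ, ∫⁻ x, min (f x) n ∂μ := by
  rw [← lintegral_iSup fun n => hf.min measurable_const]
  · refine lintegral_congr fun x => ?_
    rw [← inf_iSup_eq, ENNReal.iSup_natCast, inf_top_eq]
  · intro m n hmn x
    exact min_le_min le_rfl (by exact_mod_cast hmn)

variable {t s : ℝ}

theorem rpow_mul_rpow_le_ofReal_mul_add_ofReal_mul (ht : 0 < t) (hs : 0 < s) (hts : t + s = 1)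
    (a b : ℝ≥0∞) : a ^ t * b ^ s ≤ ENNReal.ofReal t * a + ENNReal.ofReal s * b := by
  have hyoung := ENNReal.young_inequality (a ^ t) (b ^ s) (p := t⁻¹) (q := s⁻¹)
    ⟨by simpa using hts, by positivity, by positivity⟩
  rwa [ENNReal.rpow_rpow_inv ht.ne', ENNReal.rpow_rpow_inv hs.ne', ENNReal.ofReal_inv_of_pos ht,
    ENNReal.ofReal_inv_of_pos hs, div_eq_mul_inv, div_eq_mul_inv, inv_inv, inv_inv, mul_comm a,
    mul_comm b] at hyoung

theorem ofReal_mul_volume_lt_add_le (ht : 0 < t) (hs : 0 < s) (hts : t + s = 1)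
    {f g h : ℝ → ℝ≥0∞} (hf : Measurable f) (hg : Measurable g)
    (hfgh : ∀ x y, f x ^ t * g y ^ s ≤ h (t * x + s * y)) {r : ℝ≥0∞}
    (hfr : ∃ x, r < f x) (hgr : ∃ x, r < g x) :
    ENNReal.ofReal t * volume {x | r < f x} + ENNReal.ofReal s * volume {x | r < g x}
      ≤ volume {x | r < h x} := by
  refine (ofReal_mul_volume_add_le_volume_smul_add_smul ht hs
    (measurableSet_lt measurable_const hf) (measurableSet_lt measurable_const hg) hfr hgr).trans
    (measure_mono ?_)
  rintro _ ⟨_, ⟨a, ha, rfl⟩, _, ⟨b, hb, rfl⟩, rfl⟩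
  calc r = r ^ t * r ^ s := by
        rw [← ENNReal.rpow_add_of_nonneg t s ht.le hs.le, hts, ENNReal.rpow_one]
    _ < f a ^ t * g b ^ s :=
        ENNReal.mul_lt_mul (ENNReal.rpow_lt_rpow ha ht) (ENNReal.rpow_lt_rpow hb hs)
    _ ≤ h (t * a + s * b) := hfgh a b

theorem ofReal_mul_lintegral_add_le_lintegral_of_iSup_eq_one (ht : 0 < t) (hs : 0 < s)
    (hts : t + s = 1) {f g h : ℝ → ℝ≥0∞} (hf : Measurable f) (hg : Measurable g)
    (hh : Measurable h) (hf1 : ⨆ x, f x = 1) (hg1 : ⨆ x, g x = 1)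
    (hfgh : ∀ x y, f x ^ t * g y ^ s ≤ h (t * x + s * y)) :
    ENNReal.ofReal t * (∫⁻ x, f x) + ENNReal.ofReal s * ∫⁻ x, g x ≤ ∫⁻ x, h x := by
  have hf_le : ∀ x, f x ≤ 1 := fun x => hf1 ▸ le_iSup f x
  have hg_le : ∀ x, g x ≤ 1 := fun x => hg1 ▸ le_iSup g x
  have hfgh' : ∀ x y, f x ^ t * g y ^ s ≤ min (h (t * x + s * y)) 1 := fun x y =>
    le_min (hfgh x y) (mul_le_one' (ENNReal.rpow_le_one (hf_le x) ht.le)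
      (ENNReal.rpow_le_one (hg_le y) hs.le))
  calc ENNReal.ofReal t * (∫⁻ x, f x) + ENNReal.ofReal s * ∫⁻ x, g x
      ≤ ∫⁻ r in Set.Ioi (0 : ℝ), (ENNReal.ofReal t * volume {x | ENNReal.ofReal r < f x}
          + ENNReal.ofReal s * volume {x | ENNReal.ofReal r < g x}) := by
        rw [lintegral_eq_setLIntegral_measure_ofReal_lt hf hf_le,
          lintegral_eq_setLIntegral_measure_ofReal_lt hg hg_le]
        exact (add_le_add (lintegral_const_mul_le _ _) (lintegral_const_mul_le _ _)).trans
          (le_lintegral_add _ _)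
    _ ≤ ∫⁻ r in Set.Ioi (0 : ℝ), volume {x | ENNReal.ofReal r < min (h x) 1} := by
        refine lintegral_mono fun r => ?_
        rcases lt_or_ge (ENNReal.ofReal r) 1 with hr | hr
        · exact ofReal_mul_volume_lt_add_le ht hs hts hf hg hfgh' (lt_iSup_iff.1 (hf1 ▸ hr))
            (lt_iSup_iff.1 (hg1 ▸ hr))
        · have hempty : ∀ F : ℝ → ℝ≥0∞, (∀ x, F x ≤ 1) → {x | ENNReal.ofReal r < F x} = ∅ :=
            fun F hF => Set.eq_empty_of_forall_notMem fun x hx => hx.not_ge ((hF x).trans hr)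
          simp [hempty f hf_le, hempty g hg_le]
    _ = ∫⁻ x, min (h x) 1 := (lintegral_eq_setLIntegral_measure_ofReal_lt
        (hh.min measurable_const) fun x => min_le_right _ _).symm
    _ ≤ ∫⁻ x, h x := lintegral_mono fun x => min_le_left _ _

theorem lintegral_rpow_mul_lintegral_rpow_le_of_iSup_ne_top (ht : 0 < t) (hs : 0 < s)
    (hts : t + s = 1) {f g h : ℝ → ℝ≥0∞} (hf : Measurable f) (hg : Measurable g)
    (hh : Measurable h) (hf_top : ⨆ x, f x ≠ ∞) (hg_top : ⨆ x, g x ≠ ∞)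
    (hfgh : ∀ x y, f x ^ t * g y ^ s ≤ h (t * x + s * y)) :
    (∫⁻ x, f x) ^ t * (∫⁻ x, g x) ^ s ≤ ∫⁻ x, h x := by
  set M := ⨆ x, f x
  set N := ⨆ x, g x
  rcases eq_or_ne M 0 with hM0 | hM0
  · simp [ENNReal.iSup_eq_zero.1 hM0, ht]
  rcases eq_or_ne N 0 with hN0 | hN0
  · simp [ENNReal.iSup_eq_zero.1 hN0, hs]
  set c := M⁻¹ ^ t * N⁻¹ ^ s
  have hc0 : c ≠ 0 := mul_ne_zero (by simp [hf_top, hM0]) (by simp [hg_top, hN0])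
  have hc_top : c ≠ ∞ := ENNReal.mul_ne_top
    (ENNReal.rpow_ne_top_of_nonneg ht.le (ENNReal.inv_ne_top.2 hM0))
    (ENNReal.rpow_ne_top_of_nonneg hs.le (ENNReal.inv_ne_top.2 hN0))
  have hscale : ∀ a b : ℝ≥0∞, (M⁻¹ * a) ^ t * (N⁻¹ * b) ^ s = c * (a ^ t * b ^ s) := fun a b => by
    rw [ENNReal.mul_rpow_of_nonneg _ _ ht.le, ENNReal.mul_rpow_of_nonneg _ _ hs.le,
      mul_mul_mul_comm]
  have hnormalized := ofReal_mul_lintegral_add_le_lintegral_of_iSup_eq_one ht hs hts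
    (hf.const_mul M⁻¹) (hg.const_mul N⁻¹) (hh.const_mul c)
    (by rw [← ENNReal.mul_iSup, ENNReal.inv_mul_cancel hM0 hf_top])
    (by rw [← ENNReal.mul_iSup, ENNReal.inv_mul_cancel hN0 hg_top])
    fun x y => by rw [hscale]; exact mul_le_mul_right (hfgh x y) c
  rw [lintegral_const_mul _ hf, lintegral_const_mul _ hg, lintegral_const_mul _ hh] at hnormalized
  rw [← ENNReal.mul_le_mul_iff_right hc0 hc_top, ← hscale]
  exact (rpow_mul_rpow_le_ofReal_mul_add_ofReal_mul ht hs hts _ _).trans hnormalized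

/-- A Prékopa–Leindler inequality with weights `t`, `s` for the measure `μ`. The cost `κ` is `1` for
Lebesgue measure; measures that are log-concave with respect to Lebesgue measure gain a factor
`κ x y ≥ 1`. Keeping both `κ` and `h` makes the property stable under products. -/
def SatisfiesPrekopaLeindler {E : Type*} [AddCommGroup E] [Module ℝ E] [MeasurableSpace E]
    (t s : ℝ) (κ : E → E → ℝ≥0∞) (μ : Measure E) : Prop :=
  ∀ ⦃f g h : E → ℝ≥0∞⦄, Measurable f → Measurable g → Measurable h →
    (∀ x y, f x ^ t * g y ^ s ≤ κ x y * h (t • x + s • y)) →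
    (∫⁻ x, f x ∂μ) ^ t * (∫⁻ x, g x ∂μ) ^ s ≤ ∫⁻ x, h x ∂μ

theorem satisfiesPrekopaLeindler_volume (ht : 0 < t) (hs : 0 < s) (hts : t + s = 1) :
    SatisfiesPrekopaLeindler t s (fun _ _ => 1) (volume : Measure ℝ) := by
  intro f g h hf hg hh hfgh
  simp only [one_mul, smul_eq_mul] at hfgh
  have hsup : ∀ (F : ℝ → ℝ≥0∞) (n : ℕ), ⨆ x, min (F x) (n : ℝ≥0∞) ≠ ∞ := fun F n =>
    ne_top_of_le_ne_top (ENNReal.natCast_ne_top n) (iSup_le fun x => min_le_right _ _)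
  have htrunc : ∀ m n : ℕ,
      (∫⁻ x, min (f x) m) ^ t * (∫⁻ x, min (g x) n) ^ s ≤ ∫⁻ x, h x := fun m n =>
    lintegral_rpow_mul_lintegral_rpow_le_of_iSup_ne_top ht hs hts (hf.min measurable_const)
      (hg.min measurable_const) hh (hsup f m) (hsup g n) fun x y =>
        (mul_le_mul' (ENNReal.rpow_le_rpow (min_le_left _ _) ht.le)
          (ENNReal.rpow_le_rpow (min_le_left _ _) hs.le)).trans (hfgh x y)
  have hrpow_iSup : ∀ {p : ℝ}, 0 < p → ∀ a : ℕ → ℝ≥0∞, (⨆ n, a n) ^ p = ⨆ n, a n ^ p :=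
    fun hp a => (ENNReal.orderIsoRpow _ hp).map_iSup a
  rw [lintegral_eq_iSup_lintegral_min_natCast hf, lintegral_eq_iSup_lintegral_min_natCast hg,
    hrpow_iSup ht, hrpow_iSup hs, ENNReal.iSup_mul]
  refine iSup_le fun m => ?_
  rw [ENNReal.mul_iSup]
  exact iSup_le fun n => htrunc m n

theorem gaussianPDF_rpow_mul_gaussianPDF_rpow (hts : t + s = 1) (x y : ℝ) :
    gaussianPDF 0 1 x ^ t * gaussianPDF 0 1 y ^ s
        * ENNReal.ofReal (Real.exp (t * s * ‖x - y‖ ^ 2 / 2))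
      = gaussianPDF 0 1 (t * x + s * y) := by
  have hpos : ∀ z, 0 < gaussianPDFReal 0 1 z := fun z => gaussianPDFReal_pos 0 1 z one_ne_zero
  simp only [gaussianPDF]
  rw [ENNReal.ofReal_rpow_of_pos (hpos x), ENNReal.ofReal_rpow_of_pos (hpos y),
    ← ENNReal.ofReal_mul (Real.rpow_nonneg (hpos x).le _),
    ← ENNReal.ofReal_mul (mul_nonneg (Real.rpow_nonneg (hpos x).le _)
      (Real.rpow_nonneg (hpos y).le _))]
  congr 1
  simp only [gaussianPDFReal, NNReal.coe_one, mul_one, sub_zero, Real.norm_eq_abs, sq_abs]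
  set c := (√(2 * Real.pi))⁻¹
  have hc : 0 < c := by positivity
  have hcc : c ^ t * c ^ s = c := by rw [← Real.rpow_add hc, hts, Real.rpow_one]
  rw [Real.mul_rpow hc.le (Real.exp_nonneg _), Real.mul_rpow hc.le (Real.exp_nonneg _),
    ← Real.exp_mul, ← Real.exp_mul, mul_mul_mul_comm, hcc, ← Real.exp_add, mul_assoc,
    ← Real.exp_add]
  congr 2
  obtain rfl : s = 1 - t := by linarith
  ring

theorem satisfiesPrekopaLeindler_gaussianReal (ht : 0 < t) (hs : 0 < s) (hts : t + s = 1) :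
    SatisfiesPrekopaLeindler t s
      (fun x y => ENNReal.ofReal (Real.exp (t * s * ‖x - y‖ ^ 2 / 2))) (gaussianReal 0 1) := by
  intro f g h hf hg hh hfgh
  have hφ := measurable_gaussianPDF 0 1
  rw [gaussianReal_of_var_ne_zero 0 one_ne_zero]
  simp only [lintegral_withDensity_eq_lintegral_mul _ hφ, hf, hg, hh]
  refine satisfiesPrekopaLeindler_volume ht hs hts (hφ.mul hf) (hφ.mul hg) (hφ.mul hh)
    fun x y => ?_
  simp only [Pi.mul_apply, smul_eq_mul, one_mul]
  rw [ENNReal.mul_rpow_of_nonneg _ _ ht.le, ENNReal.mul_rpow_of_nonneg _ _ hs.le,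
    mul_mul_mul_comm, ← gaussianPDF_rpow_mul_gaussianPDF_rpow hts x y, mul_assoc _ _ (h _)]
  exact mul_le_mul_right (hfgh x y) _

namespace SatisfiesPrekopaLeindler

variable {E F : Type*} [AddCommGroup E] [Module ℝ E] [MeasurableSpace E]
  [AddCommGroup F] [Module ℝ F] [MeasurableSpace F]

theorem prod {μ : Measure E} {ν : Measure F} [SFinite ν] {κ : E → E → ℝ≥0∞}
    {κ' : F → F → ℝ≥0∞} (hμ : SatisfiesPrekopaLeindler t s κ μ)
    (hν : SatisfiesPrekopaLeindler t s κ' ν) :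
    SatisfiesPrekopaLeindler t s (fun p q => κ p.1 q.1 * κ' p.2 q.2) (μ.prod ν) := by
  intro f g h hf hg hh hfgh
  have hsection : ∀ {F' : E × F → ℝ≥0∞}, Measurable F' → ∀ a, Measurable fun z => F' (a, z) :=
    fun hF' a => hF'.comp measurable_prodMk_left
  simp only [lintegral_prod _ hf.aemeasurable, lintegral_prod _ hg.aemeasurable,
    lintegral_prod _ hh.aemeasurable]
  refine hμ hf.lintegral_prod_right' hg.lintegral_prod_right' hh.lintegral_prod_right'
    fun a b => ?_
  rw [← lintegral_const_mul _ (hsection hh _)]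
  refine hν (hsection hf a) (hsection hg b) ((hsection hh _).const_mul _) fun y z => ?_
  calc f (a, y) ^ t * g (b, z) ^ s
      ≤ κ a b * κ' y z * h (t • (a, y) + s • (b, z)) := hfgh (a, y) (b, z)
    _ = κ' y z * (κ a b * h (t • a + s • b, t • y + s • z)) := by
        rw [mul_comm (κ a b), mul_assoc]; rfl

theorem map {μ : Measure E} {κ : F → F → ℝ≥0∞} {e : E →ₗ[ℝ] F} (he : Measurable e)
    (hμ : SatisfiesPrekopaLeindler t s (fun x y => κ (e x) (e y)) μ) :
    SatisfiesPrekopaLeindler t s κ (μ.map e) := by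
  intro f g h hf hg hh hfgh
  simp only [lintegral_map, hf, hg, hh, he]
  refine hμ (hf.comp he) (hg.comp he) (hh.comp he) fun x y => ?_
  simpa using hfgh (e x) (e y)

theorem pi {μ : Measure E} [SigmaFinite μ] {κ : E → E → ℝ≥0∞}
    (hμ : SatisfiesPrekopaLeindler t s κ μ) (n : ℕ) :
    SatisfiesPrekopaLeindler t s (fun x y => ∏ i, κ (x i) (y i))
      (Measure.pi fun _ : Fin n => μ) := by
  induction n with
  | zero =>
    intro f g h _ _ _ hfgh
    have hdefault := hfgh default default
    rw [Unique.eq_default (t • _ + s • _)] at hdefault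
    simpa [lintegral_unique] using hdefault
  | succ n ih =>
    have hcons := (measurePreserving_piFinSuccAbove (fun _ : Fin (n + 1) => μ) 0).symm
    have hcoe : ⇑(MeasurableEquiv.piFinSuccAbove (fun _ : Fin (n + 1) => E) 0).symm
        = ⇑(Fin.consLinearEquiv ℝ fun _ : Fin (n + 1) => E).toLinearMap := by
      ext p i
      simp [MeasurableEquiv.piFinSuccAbove_symm_apply, Fin.insertNthEquiv]
    rw [← hcons.map_eq, hcoe]
    refine map (hcoe ▸ hcons.measurable) ?_
    simpa [Fin.prod_univ_succ] using hμ.prod ih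

end SatisfiesPrekopaLeindler

theorem satisfiesPrekopaLeindler_stdGaussian {E : Type*} [NormedAddCommGroup E]
    [InnerProductSpace ℝ E] [FiniteDimensional ℝ E] [MeasurableSpace E] [BorelSpace E]
    (ht : 0 < t) (hs : 0 < s) (hts : t + s = 1) :
    SatisfiesPrekopaLeindler t s
      (fun x y : E => ENNReal.ofReal (Real.exp (t * s * ‖x - y‖ ^ 2 / 2))) (stdGaussian E) := by
  let b := stdOrthonormalBasis ℝ E
  let e : (Fin (Module.finrank ℝ E) → ℝ) →ₗ[ℝ] E := Fintype.linearCombination ℝ b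
  have he : ⇑e = fun x => ∑ i, x i • b i := rfl
  have hnorm : ∀ x, ‖e x‖ ^ 2 = ∑ i, ‖x i‖ ^ 2 := fun x => by
    rw [← b.sum_sq_norm_inner_right]
    simp [he, b.orthonormal.inner_right_fintype]
  rw [stdGaussian_eq_map_pi_orthonormalBasis b, ← he]
  refine SatisfiesPrekopaLeindler.map e.continuous_of_finiteDimensional.measurable ?_
  have hcost : ∀ x y, ENNReal.ofReal (Real.exp (t * s * ‖e x - e y‖ ^ 2 / 2))
      = ∏ i, ENNReal.ofReal (Real.exp (t * s * ‖x i - y i‖ ^ 2 / 2)) := fun x y => by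
    rw [← map_sub, hnorm, Finset.mul_sum, Finset.sum_div, Real.exp_sum,
      ENNReal.ofReal_prod_of_nonneg fun i _ => (Real.exp_pos _).le]
    rfl
  simpa only [hcost] using (satisfiesPrekopaLeindler_gaussianReal ht hs hts).pi _

end PrekopaLeindler

section Transport

variable {E : Type*} [NormedAddCommGroup E] [InnerProductSpace ℝ E] [FiniteDimensional ℝ E]
  [MeasurableSpace E] [BorelSpace E]

theorem ofReal_exp_integral_le_lintegral_exp {α : Type*} [MeasurableSpace α] {μ : Measure α}
    [IsProbabilityMeasure μ] {g : α → ℝ} (hg : Integrable g μ) :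
    ENNReal.ofReal (Real.exp (∫ x, g x ∂μ)) ≤ ∫⁻ x, ENNReal.ofReal (Real.exp (g x)) ∂μ := by
  by_cases hexp : Integrable (fun x => Real.exp (g x)) μ
  · rw [← ofReal_integral_eq_lintegral_ofReal hexp (ae_of_all _ fun x => (Real.exp_pos _).le)]
    exact ENNReal.ofReal_le_ofReal (convexOn_exp.map_integral_le Real.continuous_exp.continuousOn
      isClosed_univ (by simp) hg hexp)
  · have htop : ∫⁻ x, ENNReal.ofReal (Real.exp (g x)) ∂μ = ∞ := by
      by_contra hne
      exact hexp ((lintegral_ofReal_ne_top_iff_integrable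
        (Real.continuous_exp.comp_aestronglyMeasurable hg.1)
        (ae_of_all _ fun x => (Real.exp_pos _).le)).1 hne)
    rw [htop]
    exact le_top

theorem lintegral_exp_le_of_forall_le_add_mul_sq {s : ℝ} (hs : 0 < s) (hs1 : s < 1) {u g : E → ℝ}
    (hu : Measurable u) (hg : Measurable g) (hg_int : Integrable g (stdGaussian E))
    (hug : ∀ x y, u x ≤ g y + s * ‖x - y‖ ^ 2 / 2) :
    ∫⁻ x, ENNReal.ofReal (Real.exp (u x)) ∂stdGaussian E
      ≤ ENNReal.ofReal (Real.exp (∫ x, g x ∂stdGaussian E)) := by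
  set I := ∫⁻ x, ENNReal.ofReal (Real.exp (u x)) ∂stdGaussian E
  set m := ∫ x, g x ∂stdGaussian E
  obtain ⟨t, rfl⟩ : ∃ t, s = 1 - t := ⟨1 - s, by ring⟩
  have ht : 0 < t := by linarith
  have hofReal_rpow : ∀ a p : ℝ,
      ENNReal.ofReal (Real.exp a) ^ p = ENNReal.ofReal (Real.exp (a * p)) := fun a p => by
    rw [ENNReal.ofReal_rpow_of_pos (Real.exp_pos _), Real.exp_mul]
  -- Prékopa–Leindler with weights `t`, `1 - t` for `exp u`, `exp (-t g / (1 - t))` and `1`.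
  have hdual : I ^ t * ENNReal.ofReal (Real.exp (-(t * m))) ≤ 1 := by
    have hpl := satisfiesPrekopaLeindler_stdGaussian ht hs (by ring) (h := fun _ => 1)
      hu.exp.ennreal_ofReal (hg.const_mul (-(t / (1 - t)))).exp.ennreal_ofReal measurable_const
      fun x y => by
        rw [hofReal_rpow, hofReal_rpow, ← ENNReal.ofReal_mul (Real.exp_pos _).le, ← Real.exp_add,
          mul_one]
        refine ENNReal.ofReal_le_ofReal (Real.exp_le_exp.2 ?_)
        have hscaled := mul_le_mul_of_nonneg_left (hug x y) ht.le
        have hcancel : -(t / (1 - t)) * g y * (1 - t) = -(t * g y) := by field_simp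
        rw [hcancel]
        linarith
    have hjensen := ENNReal.rpow_le_rpow
      (ofReal_exp_integral_le_lintegral_exp (hg_int.const_mul (-(t / (1 - t))))) hs.le
    have hcancel : -(t / (1 - t)) * m * (1 - t) = -(t * m) := by field_simp
    rw [integral_const_mul, hofReal_rpow, hcancel] at hjensen
    simpa using (mul_le_mul_right hjensen (I ^ t)).trans hpl
  rw [← ENNReal.rpow_le_rpow_iff ht, hofReal_rpow, mul_comm m]
  rwa [Real.exp_neg, ENNReal.ofReal_inv_of_pos (Real.exp_pos _), ← div_eq_mul_inv,
    ENNReal.div_le_iff (ENNReal.ofReal_pos.2 (Real.exp_pos _)).ne' ENNReal.ofReal_ne_top,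
    one_mul] at hdual

/-- The dual (Bobkov–Götze) form of Talagrand's transport inequality. -/
theorem lintegral_exp_le_of_forall_le_add_sq {u g : E → ℝ} (hu : Measurable u) (hg : Measurable g)
    (hg_int : Integrable g (stdGaussian E)) (hug : ∀ x y, u x ≤ g y + ‖x - y‖ ^ 2 / 2) :
    ∫⁻ x, ENNReal.ofReal (Real.exp (u x)) ∂stdGaussian E
      ≤ ENNReal.ofReal (Real.exp (∫ x, g x ∂stdGaussian E)) := by
  have hscaled : ∀ᶠ s : ℝ in 𝓝[<] 1, ∫⁻ x, ENNReal.ofReal (Real.exp (s * u x)) ∂stdGaussian E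
      ≤ ENNReal.ofReal (Real.exp (s * ∫ x, g x ∂stdGaussian E)) := by
    filter_upwards [Ioo_mem_nhdsLT one_pos] with s hs
    rw [← integral_const_mul]
    refine lintegral_exp_le_of_forall_le_add_mul_sq hs.1 hs.2 (hu.const_mul s) (hg.const_mul s)
      (hg_int.const_mul s) fun x y => ?_
    linarith [mul_le_mul_of_nonneg_left (hug x y) hs.1.le]
  have hlim : ∀ a : ℝ, Tendsto (fun s : ℝ => ENNReal.ofReal (Real.exp (s * a))) (𝓝[<] 1)
      (𝓝 (ENNReal.ofReal (Real.exp a))) := fun a => by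
    have hcont : Continuous fun s : ℝ => ENNReal.ofReal (Real.exp (s * a)) :=
      ENNReal.continuous_ofReal.comp (by fun_prop)
    simpa using (hcont.tendsto 1).mono_left nhdsWithin_le_nhds
  calc ∫⁻ x, ENNReal.ofReal (Real.exp (u x)) ∂stdGaussian E
      = ∫⁻ x, liminf (fun s : ℝ => ENNReal.ofReal (Real.exp (s * u x))) (𝓝[<] 1)
          ∂stdGaussian E := lintegral_congr fun x => (hlim (u x)).liminf_eq.symm
    _ ≤ liminf (fun s : ℝ => ∫⁻ x, ENNReal.ofReal (Real.exp (s * u x)) ∂stdGaussian E) (𝓝[<] 1) :=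
        lintegral_liminf_le fun s => (hu.const_mul s).exp.ennreal_ofReal
    _ ≤ liminf (fun s : ℝ => ENNReal.ofReal (Real.exp (s * ∫ x, g x ∂stdGaussian E))) (𝓝[<] 1) :=
        liminf_le_liminf hscaled
    _ = ENNReal.ofReal (Real.exp (∫ x, g x ∂stdGaussian E)) := (hlim _).liminf_eq

variable {f : E → ℝ} {L : ℝ≥0}

theorem integrable_sq_stdGaussian_of_lipschitzWith (hf : LipschitzWith L f) :
    Integrable (fun x => f x ^ 2) (stdGaussian E) := by
  have hbound : ∀ x, ‖f x‖ ≤ ‖|f 0| + L * ‖x‖‖ := fun x => by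
    have hdist := hf.dist_le_mul x 0
    rw [Real.dist_eq, dist_zero_right] at hdist
    rw [Real.norm_eq_abs]
    exact le_trans (by linarith [abs_sub_abs_le_abs_sub (f x) (f 0)]) (Real.le_norm_self _)
  have hid : MemLp (fun x : E => x) 2 (stdGaussian E) := IsGaussian.memLp_two_id
  exact (((memLp_const |f 0|).add (hid.norm.const_mul (L : ℝ))).mono
    hf.continuous.aestronglyMeasurable (ae_of_all _ hbound)).integrable_sq

theorem mul_sq_le_div_mul_sq_add {a b d L lam : ℝ} (hL : 2 * L ^ 2 * lam < 1)
    (hab : |a - b| ≤ L * d) :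
    lam * a ^ 2 ≤ lam / (1 - 2 * L ^ 2 * lam) * b ^ 2 + d ^ 2 / 2 := by
  rcases eq_or_ne L 0 with rfl | hL0
  · have hab0 : a = b := by simpa [sub_eq_zero] using hab
    simp only [hab0, ne_eq, OfNat.ofNat_ne_zero, not_false_eq_true, zero_pow, mul_zero, zero_mul,
      sub_zero, div_one, le_add_iff_nonneg_right]
    positivity
  set k := 1 - 2 * L ^ 2 * lam with hk
  have hk0 : 0 < k := sub_pos.2 hL
  have hlam : lam = (1 - k) / (2 * L ^ 2) := by rw [hk]; field_simp; ring
  have hd : (a - b) ^ 2 / L ^ 2 ≤ d ^ 2 := by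
    rw [div_le_iff₀ (by positivity), mul_comm, ← mul_pow, ← sq_abs]
    gcongr
  have hsquare : lam / k * b ^ 2 + (a - b) ^ 2 / L ^ 2 / 2 - lam * a ^ 2
      = (b - k * a) ^ 2 / (2 * L ^ 2 * k) := by
    rw [hlam]
    field_simp
    ring
  have hnonneg : 0 ≤ (b - k * a) ^ 2 / (2 * L ^ 2 * k) := by positivity
  linarith

theorem lintegral_exp_mul_sq_le_of_lipschitzWith (hf : LipschitzWith L f) {lam : ℝ}
    (hlam : 2 * (L : ℝ) ^ 2 * lam < 1) :
    ∫⁻ x, ENNReal.ofReal (Real.exp (lam * f x ^ 2)) ∂stdGaussian E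
      ≤ ENNReal.ofReal
          (Real.exp (lam / (1 - 2 * (L : ℝ) ^ 2 * lam) * ∫ x, f x ^ 2 ∂stdGaussian E)) := by
  have hmeas : Measurable fun x => f x ^ 2 := hf.continuous.measurable.pow_const 2
  rw [← integral_const_mul]
  refine lintegral_exp_le_of_forall_le_add_sq (hmeas.const_mul _) (hmeas.const_mul _)
    ((integrable_sq_stdGaussian_of_lipschitzWith hf).const_mul _) fun x y => ?_
  exact mul_sq_le_div_mul_sq_add hlam
    (by simpa [Real.dist_eq, dist_eq_norm] using hf.dist_le_mul x y)

end Transport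

section SubGamma

variable {Ω : Type*} [MeasurableSpace Ω]

/-- The sub-gamma (Bernstein) condition with variance factor `v` and scale `c`: the moment
generating function of `Y` at `lam` is at most `exp (v * lam ^ 2 / (2 * (1 - c * lam)))` whenever
`c * lam < 1`. As for `HasSubgaussianMGF`, this forces `Y` to be centred. -/
structure HasSubgammaMGF (Y : Ω → ℝ) (v c : ℝ) (P : Measure Ω) : Prop where
  integrable_exp_mul : ∀ lam : ℝ, c * lam < 1 → Integrable (fun ω => Real.exp (lam * Y ω)) P
  mgf_le : ∀ lam : ℝ, c * lam < 1 → mgf Y P lam ≤ Real.exp (v * lam ^ 2 / (2 * (1 - c * lam)))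

theorem one_add_sq_div_two_le_cosh (y : ℝ) : 1 + y ^ 2 / 2 ≤ Real.cosh y := by
  simpa [Finset.sum_range_succ] using
    sum_le_hasSum (Finset.range 2)
      (fun n _ => div_nonneg ((even_two_mul n).pow_nonneg y) (Nat.cast_nonneg _))
      (Real.hasSum_cosh y)

namespace HasSubgammaMGF

variable {P : Measure Ω} {Y : Ω → ℝ} {v c : ℝ}

theorem comp_hasLaw {Ω' : Type*} [MeasurableSpace Ω'] {Q : Measure Ω'} {X : Ω' → Ω}
    (hY : HasSubgammaMGF Y v c P) (hX : HasLaw X P Q) :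
    HasSubgammaMGF (fun ω => Y (X ω)) v c Q := by
  obtain ⟨hX_meas, rfl⟩ := hX
  refine ⟨fun lam hlam => (hY.integrable_exp_mul lam hlam).comp_aemeasurable hX_meas,
    fun lam hlam => ?_⟩
  have hmgf := hY.mgf_le lam hlam
  rwa [mgf_map hX_meas (hY.integrable_exp_mul lam hlam).aestronglyMeasurable] at hmgf

theorem memLp (hY : HasSubgammaMGF Y v c P) (p : ℝ≥0) : MemLp Y p P := by
  refine memLp_of_mem_interior_integrableExpSet ?_ p
  have hcont : Continuous fun lam : ℝ => c * lam := by fun_prop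
  exact interior_maximal (fun lam hlam => hY.integrable_exp_mul lam hlam)
    (isOpen_lt hcont continuous_const) (show c * 0 < 1 by simp)

variable [IsProbabilityMeasure P]

theorem sq_mul_integral_sq_le (hY : HasSubgammaMGF Y v c P) {lam : ℝ} (hpos : c * lam < 1)
    (hneg : c * -lam < 1) :
    lam ^ 2 * ∫ ω, Y ω ^ 2 ∂P ≤ mgf Y P lam + mgf Y P (-lam) - 2 := by
  have hint : Integrable (fun ω => Real.exp (lam * Y ω) + Real.exp (-lam * Y ω)) P :=
    (hY.integrable_exp_mul lam hpos).add (hY.integrable_exp_mul _ hneg)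
  have hpointwise : ∀ ω, lam ^ 2 * Y ω ^ 2
      ≤ Real.exp (lam * Y ω) + Real.exp (-lam * Y ω) - 2 := fun ω => by
    have hcosh := one_add_sq_div_two_le_cosh (lam * Y ω)
    rw [Real.cosh_eq, ← neg_mul] at hcosh
    linarith [mul_pow lam (Y ω) 2]
  calc lam ^ 2 * ∫ ω, Y ω ^ 2 ∂P = ∫ ω, lam ^ 2 * Y ω ^ 2 ∂P := (integral_const_mul _ _).symm
    _ ≤ ∫ ω, (Real.exp (lam * Y ω) + Real.exp (-lam * Y ω) - 2) ∂P :=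
        integral_mono ((hY.memLp 2).integrable_sq.const_mul _) (hint.sub (integrable_const 2))
          hpointwise
    _ = mgf Y P lam + mgf Y P (-lam) - 2 := by
        rw [integral_sub hint (integrable_const 2), integral_add (hY.integrable_exp_mul lam hpos)
          (hY.integrable_exp_mul _ hneg)]
        simp [mgf]

theorem integral_sq_le (hY : HasSubgammaMGF Y v c P) : ∫ ω, Y ω ^ 2 ∂P ≤ v := by
  let w : ℝ → ℝ := fun lam => v / (2 * (1 - c * lam))
  let B : ℝ → ℝ := fun lam => w lam * Real.exp (lam ^ 2 * w lam)
  have hmgf : ∀ lam, c * lam < 1 → mgf Y P lam - 1 ≤ lam ^ 2 * B lam := fun lam hlam => by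
    have hexp := Real.add_one_le_exp (-(lam ^ 2 * w lam))
    have hmul : Real.exp (-(lam ^ 2 * w lam)) * Real.exp (lam ^ 2 * w lam) = 1 := by
      rw [← Real.exp_add, neg_add_cancel, Real.exp_zero]
    have hle : mgf Y P lam ≤ Real.exp (lam ^ 2 * w lam) := by
      convert hY.mgf_le lam hlam using 2
      ring
    nlinarith [Real.exp_pos (lam ^ 2 * w lam)]
  have hle : ∀ᶠ lam in 𝓝[≠] 0, ∫ ω, Y ω ^ 2 ∂P ≤ B lam + B (-lam) := by
    have hpos : ∀ᶠ lam : ℝ in 𝓝 0, c * lam < 1 :=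
      (by fun_prop : Continuous fun lam : ℝ => c * lam).tendsto' 0 0 (by simp)
        |>.eventually_lt_const one_pos
    have hneg : ∀ᶠ lam : ℝ in 𝓝 0, c * -lam < 1 :=
      (by fun_prop : Continuous fun lam : ℝ => c * -lam).tendsto' 0 0 (by simp)
        |>.eventually_lt_const one_pos
    filter_upwards [hpos.filter_mono nhdsWithin_le_nhds, hneg.filter_mono nhdsWithin_le_nhds,
      self_mem_nhdsWithin] with lam hpos hneg hlam
    refine le_of_mul_le_mul_left ?_ (pow_pos (abs_pos.2 hlam) 2)
    rw [sq_abs]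
    linarith [hY.sq_mul_integral_sq_le hpos hneg, hmgf lam hpos, hmgf _ hneg, neg_sq lam]
  have hlim : Tendsto (fun lam => B lam + B (-lam)) (𝓝[≠] 0) (𝓝 v) := by
    have hcont : ContinuousAt (fun lam => B lam + B (-lam)) 0 := by
      fun_prop (disch := simp)
    convert hcont.tendsto.mono_left nhdsWithin_le_nhds using 2
    simp [B, w]
  exact ge_of_tendsto hlim hle

theorem memLp_two_of_sub_const {X : Ω → ℝ} {a : ℝ}
    (hX : HasSubgammaMGF (fun ω => X ω - a) v c P) : MemLp X 2 P := by
  simpa [Function.comp_def, Pi.add_def] using (hX.memLp 2).add (memLp_const a)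

theorem variance_le {X : Ω → ℝ} (hX : HasSubgammaMGF (fun ω => X ω - ∫ ω', X ω' ∂P) v c P) :
    variance X P ≤ v := by
  rw [variance_eq_integral hX.memLp_two_of_sub_const.aestronglyMeasurable.aemeasurable]
  exact hX.integral_sq_le

theorem varianceFactor_nonneg (hY : HasSubgammaMGF Y v c P) : 0 ≤ v :=
  (integral_nonneg fun _ => sq_nonneg _).trans hY.integral_sq_le

theorem measureReal_ge_le_exp (hY : HasSubgammaMGF Y v c P) (hc : 0 ≤ c) {r : ℝ} (hr : 0 ≤ r) :
    P.real {ω | v * r + c * (v * r ^ 2 / 2) ≤ Y ω} ≤ Real.exp (-(v * r ^ 2 / 2)) := by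
  -- `lam = r / (1 + c r)` is optimal in Chernoff's bound.
  have hone_sub : 1 - c * (r / (1 + c * r)) = 1 / (1 + c * r) := by field_simp; ring
  have hlam : c * (r / (1 + c * r)) < 1 := by
    rw [← sub_pos, hone_sub]
    positivity
  calc P.real {ω | v * r + c * (v * r ^ 2 / 2) ≤ Y ω}
      ≤ Real.exp (-(r / (1 + c * r)) * (v * r + c * (v * r ^ 2 / 2)))
          * mgf Y P (r / (1 + c * r)) :=
        measure_ge_le_exp_mul_mgf _ (by positivity) (hY.integrable_exp_mul _ hlam)
    _ ≤ Real.exp (-(r / (1 + c * r)) * (v * r + c * (v * r ^ 2 / 2)))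
          * Real.exp (v * (r / (1 + c * r)) ^ 2 / (2 * (1 - c * (r / (1 + c * r))))) := by
        gcongr
        exact hY.mgf_le _ hlam
    _ = Real.exp (-(v * r ^ 2 / 2)) := by
        rw [← Real.exp_add, hone_sub]
        congr 1
        field_simp
        ring

theorem measureReal_le_neg_le_exp (hY : HasSubgammaMGF Y v c P) (hc : 0 ≤ c) {r : ℝ}
    (hr : 0 ≤ r) : P.real {ω | Y ω ≤ -(v * r)} ≤ Real.exp (-(v * r ^ 2 / 2)) := by
  have hv := hY.varianceFactor_nonneg
  have hcr : 0 ≤ c * r := mul_nonneg hc hr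
  have hlam : c * -r < 1 := by linarith
  calc P.real {ω | Y ω ≤ -(v * r)} ≤ Real.exp (- -r * -(v * r)) * mgf Y P (-r) :=
        measure_le_le_exp_mul_mgf _ (by linarith) (hY.integrable_exp_mul _ hlam)
    _ ≤ Real.exp (- -r * -(v * r)) * Real.exp (v * r ^ 2 / 2) := by
        gcongr
        refine (hY.mgf_le _ hlam).trans (Real.exp_le_exp.2 ?_)
        rw [neg_sq]
        gcongr
        linarith
    _ = Real.exp (-(v * r ^ 2 / 2)) := by
        rw [← Real.exp_add]
        ring_nf

theorem ae_eq_zero (hY : HasSubgammaMGF Y 0 c P) : Y =ᵐ[P] 0 := by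
  have hzero := le_antisymm hY.integral_sq_le (integral_nonneg fun ω => sq_nonneg (Y ω))
  filter_upwards [(integral_eq_zero_iff_of_nonneg (fun ω => sq_nonneg (Y ω))
    (hY.memLp 2).integrable_sq).1 hzero] with ω hω
  exact pow_eq_zero_iff two_ne_zero |>.1 hω

theorem measureReal_abs_ge_le_two_mul_exp (hY : HasSubgammaMGF Y v c P) (hc : 0 < c) {t : ℝ}
    (ht : 0 ≤ t) : P.real {ω | √(2 * v * t) + c * t ≤ |Y ω|} ≤ 2 * Real.exp (-t) := by
  rcases ht.eq_or_lt with rfl | ht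
  · exact measureReal_le_one.trans (by norm_num)
  rcases hY.varianceFactor_nonneg.eq_or_lt with rfl | hv
  · have hnull : P {ω | √(2 * 0 * t) + c * t ≤ |Y ω|} = 0 := by
      refine measure_mono_null (fun ω hω => ?_) (ae_iff.1 hY.ae_eq_zero)
      have hpos : 0 < c * t := by positivity
      have habs : c * t ≤ |Y ω| := by simpa using hω
      exact abs_pos.1 (hpos.trans_le habs)
    rw [measureReal_def, hnull, ENNReal.toReal_zero]
    positivity
  set r := √(2 * t / v)
  have hr : v * r ^ 2 / 2 = t := by
    rw [Real.sq_sqrt (by positivity)]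
    field_simp
  have hsqrt : √(2 * v * t) = v * r := by
    rw [Real.sqrt_eq_iff_mul_self_eq (by positivity) (by positivity)]
    linear_combination (-2 * v) * hr
  have hupper := hY.measureReal_ge_le_exp hc.le (Real.sqrt_nonneg (2 * t / v))
  have hlower := hY.measureReal_le_neg_le_exp hc.le (Real.sqrt_nonneg (2 * t / v))
  rw [hr] at hupper hlower
  calc P.real {ω | √(2 * v * t) + c * t ≤ |Y ω|}
      ≤ P.real ({ω | v * r + c * t ≤ Y ω} ∪ {ω | Y ω ≤ -(v * r)}) := by
        refine measureReal_mono fun ω hω => ?_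
        rw [Set.mem_ofPred_eq, hsqrt] at hω
        rcases le_abs.1 hω with habs | habs
        · exact Or.inl habs
        · exact Or.inr (by rw [Set.mem_ofPred_eq]; linarith [mul_pos hc ht])
    _ ≤ 2 * Real.exp (-t) := (measureReal_union_le _ _).trans (by linarith)

end HasSubgammaMGF

theorem hasSubgammaMGF_sq_sub_integral_of_lipschitzWith {E : Type*} [NormedAddCommGroup E]
    [InnerProductSpace ℝ E] [FiniteDimensional ℝ E] [MeasurableSpace E] [BorelSpace E]
    {f : E → ℝ} {L : ℝ≥0} (hf : LipschitzWith L f) :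
    HasSubgammaMGF (fun x => f x ^ 2 - ∫ y, f y ^ 2 ∂stdGaussian E)
      (4 * L ^ 2 * ∫ y, f y ^ 2 ∂stdGaussian E) (2 * L ^ 2) (stdGaussian E) := by
  set m := ∫ y, f y ^ 2 ∂stdGaussian E
  have hnonneg : ∀ lam, 0 ≤ᵐ[stdGaussian E] fun x => Real.exp (lam * f x ^ 2) := fun lam =>
    ae_of_all _ fun x => (Real.exp_pos _).le
  have hcont := hf.continuous
  have hint : ∀ lam : ℝ, 2 * (L : ℝ) ^ 2 * lam < 1 →
      Integrable (fun x => Real.exp (lam * f x ^ 2)) (stdGaussian E) := fun lam hlam =>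
    (lintegral_ofReal_ne_top_iff_integrable (by fun_prop) (hnonneg lam)).1
      (ne_top_of_le_ne_top ENNReal.ofReal_ne_top (lintegral_exp_mul_sq_le_of_lipschitzWith hf hlam))
  simp only [sub_eq_add_neg]
  refine ⟨fun lam hlam => ?_, fun lam hlam => ?_⟩
  · simpa only [mul_add, Real.exp_add] using (hint lam hlam).mul_const _
  · have hk : 0 < 1 - 2 * (L : ℝ) ^ 2 * lam := sub_pos.2 hlam
    have hmgf : mgf (fun x => f x ^ 2) (stdGaussian E) lam
        ≤ Real.exp (lam / (1 - 2 * (L : ℝ) ^ 2 * lam) * m) := by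
      rw [← ENNReal.ofReal_le_ofReal_iff (Real.exp_pos _).le, mgf,
        ofReal_integral_eq_lintegral_ofReal (hint lam hlam) (hnonneg lam)]
      exact lintegral_exp_mul_sq_le_of_lipschitzWith hf hlam
    rw [mgf_add_const]
    calc mgf (fun x => f x ^ 2) (stdGaussian E) lam * Real.exp (lam * -m)
        ≤ Real.exp (lam / (1 - 2 * (L : ℝ) ^ 2 * lam) * m) * Real.exp (lam * -m) := by gcongr
      _ = Real.exp (4 * L ^ 2 * m * lam ^ 2 / (2 * (1 - 2 * L ^ 2 * lam))) := by
          rw [← Real.exp_add]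
          congr 1
          set k := 1 - 2 * (L : ℝ) ^ 2 * lam with hk_def
          field_simp
          rw [hk_def]
          ring

end SubGamma

section Projection

variable {n : ℕ} {K : Set (EuclideanSpace ℝ (Fin n))} (μ x : EuclideanSpace ℝ (Fin n))

/-- The standing assumption on a constraint set, under which the projection on it is well
defined. -/
structure NonemptyClosedConvex (K : Set (EuclideanSpace ℝ (Fin n))) : Prop where
  nonempty : K.Nonempty
  isClosed : IsClosed K
  convex : Convex ℝ K

namespace NonemptyClosedConvex

theorem isProjOn_convexProj (hK : NonemptyClosedConvex K) : IsProjOn K x (convexProj K x) :=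
  convexProj_spec hK.nonempty hK.isClosed hK.convex x

theorem convexProj_mem (hK : NonemptyClosedConvex K) : convexProj K x ∈ K :=
  (hK.isProjOn_convexProj x).1

theorem convexProj_eq_of_isProjOn (hK : NonemptyClosedConvex K) {x p : EuclideanSpace ℝ (Fin n)}
    (hp : IsProjOn K x p) : convexProj K x = p :=
  (existsUnique_isProjOn hK.nonempty hK.isClosed hK.convex x).unique (hK.isProjOn_convexProj x) hp

theorem convexProj_eq_self (hK : NonemptyClosedConvex K) {x : EuclideanSpace ℝ (Fin n)}
    (hx : x ∈ K) : convexProj K x = x :=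
  hK.convexProj_eq_of_isProjOn ⟨hx, fun q _ => by simp⟩

theorem inner_sub_convexProj_nonpos (hK : NonemptyClosedConvex K) {q : EuclideanSpace ℝ (Fin n)}
    (hq : q ∈ K) : ⟪x - convexProj K x, q - convexProj K x⟫ ≤ 0 := by
  obtain ⟨hmem, hmin⟩ := hK.isProjOn_convexProj x
  have : Nonempty K := hK.nonempty.to_subtype
  refine (norm_eq_iInf_iff_real_inner_le_zero hK.convex hmem).1 (le_antisymm ?_ ?_) q hq
  · exact le_ciInf fun w => (sq_le_sq₀ (norm_nonneg _) (norm_nonneg _)).1 (hmin w w.2)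
  · exact ciInf_le ⟨0, by rintro _ ⟨w, rfl⟩; exact norm_nonneg _⟩ (⟨_, hmem⟩ : K)

theorem norm_sub_convexProj_sq_add_le (hK : NonemptyClosedConvex K)
    {q : EuclideanSpace ℝ (Fin n)} (hq : q ∈ K) :
    ‖x - convexProj K x‖ ^ 2 + ‖q - convexProj K x‖ ^ 2 ≤ ‖x - q‖ ^ 2 := by
  have hexpand := norm_sub_sq_real (x - convexProj K x) (q - convexProj K x)
  rw [sub_sub_sub_cancel_right] at hexpand
  linarith [hK.inner_sub_convexProj_nonpos x hq]

theorem lipschitzWith_convexProj (hK : NonemptyClosedConvex K) :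
    LipschitzWith 1 (convexProj K) := by
  refine LipschitzWith.of_dist_le_mul fun x y => ?_
  rw [NNReal.coe_one, one_mul, dist_eq_norm, dist_eq_norm]
  set p := convexProj K x
  set q := convexProj K y
  have hfirm : ‖p - q‖ ^ 2 ≤ ⟪x - y, p - q⟫ := by
    have hx := hK.inner_sub_convexProj_nonpos x (hK.convexProj_mem y)
    have hy := hK.inner_sub_convexProj_nonpos y (hK.convexProj_mem x)
    have hsplit : ⟪x - y, p - q⟫ = ‖p - q‖ ^ 2 - ⟪x - p, q - p⟫ - ⟪y - q, p - q⟫ := by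
      rw [← real_inner_self_eq_norm_sq, ← neg_sub p q, inner_neg_right, sub_neg_eq_add,
        ← inner_add_left, ← inner_sub_left]
      congr 1
      abel
    linarith
  by_contra! hlt
  nlinarith [hfirm.trans (real_inner_le_norm _ _), norm_nonneg (x - y)]

theorem lipschitzWith_norm_convexProj_smul (hK : NonemptyClosedConvex K) (σ : ℝ) :
    LipschitzWith ‖σ‖₊ fun x => ‖convexProj K (σ • x)‖ := by
  simpa [Function.comp_def] using
    lipschitzWith_one_norm.comp (hK.lipschitzWith_convexProj.comp (lipschitzWith_smul σ))

theorem norm_convexProj_le (hK : NonemptyClosedConvex K) (h0 : 0 ∈ K) :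
    ‖convexProj K x‖ ≤ ‖x‖ := by
  simpa [hK.convexProj_eq_self h0] using hK.lipschitzWith_convexProj.dist_le_mul x 0

theorem norm_convexProj_smul_sq_div_sq_le (hK : NonemptyClosedConvex K) (h0 : 0 ∈ K) {σ : ℝ}
    (hσ : 0 < σ) : ‖convexProj K (σ • x)‖ ^ 2 / σ ^ 2 ≤ ‖x‖ ^ 2 := by
  rw [div_le_iff₀ (by positivity), ← mul_pow]
  have hle := hK.norm_convexProj_le (σ • x) h0
  rw [norm_smul, Real.norm_of_nonneg hσ.le, mul_comm] at hle
  gcongr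

theorem mul_norm_convexProj_smul_le (hK : NonemptyClosedConvex K) {s t : ℝ} (hs : 0 < s)
    (hst : s ≤ t) : s * ‖convexProj K (t • x)‖ ≤ t * ‖convexProj K (s • x)‖ := by
  set a := convexProj K (s • x)
  set b := convexProj K (t • x)
  have ht : 0 < t := hs.trans_le hst
  have ha : ⟪s • x - a, b - a⟫ ≤ 0 :=
    hK.inner_sub_convexProj_nonpos (s • x) (hK.convexProj_mem _)
  have hb : ⟪t • x - b, a - b⟫ ≤ 0 :=
    hK.inner_sub_convexProj_nonpos (t • x) (hK.convexProj_mem _)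
  simp only [inner_sub_left, inner_sub_right, real_inner_smul_left, real_inner_self_eq_norm_sq]
    at ha hb
  rw [real_inner_comm a b] at hb
  have hcombined : s * ‖b‖ ^ 2 + t * ‖a‖ ^ 2 ≤ (s + t) * (‖a‖ * ‖b‖) := by
    have hcs := mul_le_mul_of_nonneg_left (real_inner_le_norm a b) (add_pos hs ht).le
    nlinarith [mul_le_mul_of_nonneg_left ha ht.le, mul_le_mul_of_nonneg_left hb hs.le]
  have hfactor : (s * ‖b‖ - t * ‖a‖) * (‖b‖ - ‖a‖) ≤ 0 := by linarith
  by_contra! hlt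
  have hab : ‖a‖ < ‖b‖ := by
    refine lt_of_mul_lt_mul_left (lt_of_le_of_lt ?_ hlt) hs.le
    gcongr
  exact hfactor.not_gt (mul_pos (sub_pos.2 hlt) (sub_pos.2 hab))

theorem antitoneOn_norm_convexProj_smul_sq_div_sq (hK : NonemptyClosedConvex K) :
    AntitoneOn (fun σ : ℝ => ‖convexProj K (σ • x)‖ ^ 2 / σ ^ 2) (Set.Ioi 0) := by
  intro s (hs : 0 < s) t (ht : 0 < t) hst
  simp only [← div_pow]
  refine pow_le_pow_left₀ (by positivity) ?_ 2
  rw [div_le_div_iff₀ ht hs, mul_comm _ s, mul_comm _ t]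
  exact hK.mul_norm_convexProj_smul_le x hs hst

theorem preimage_const_add (hK : NonemptyClosedConvex K) :
    NonemptyClosedConvex ((μ + ·) ⁻¹' K) where
  nonempty := hK.nonempty.preimage (add_left_surjective μ)
  isClosed := hK.isClosed.preimage (continuous_const_add μ)
  convex := hK.convex.translate_preimage_right μ

theorem convexProj_preimage_const_add (hK : NonemptyClosedConvex K) :
    convexProj ((μ + ·) ⁻¹' K) x = convexProj K (μ + x) - μ := by
  refine (hK.preimage_const_add μ).convexProj_eq_of_isProjOn ⟨?_, fun q hq => ?_⟩
  · simpa using hK.convexProj_mem (μ + x)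
  · have hmin := (hK.isProjOn_convexProj (μ + x)).2 _ hq
    rwa [sub_sub_eq_add_sub, add_comm x μ, ← add_sub_add_left_eq_sub x q μ]

end NonemptyClosedConvex

end Projection

section HighNoise

variable {n : ℕ} {K : Set (EuclideanSpace ℝ (Fin n))} (μ x : EuclideanSpace ℝ (Fin n))

/-- The limit of `‖Π_K(σ x)‖² / σ²` as `σ → ∞`; the quotient decreases in `σ`, so the limit is the
infimum. -/
noncomputable def highNoiseLimit (K : Set (EuclideanSpace ℝ (Fin n)))
    (x : EuclideanSpace ℝ (Fin n)) : ℝ :=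
  ⨅ σ : Set.Ioi (0 : ℝ), ‖convexProj K ((σ : ℝ) • x)‖ ^ 2 / (σ : ℝ) ^ 2

theorem bddBelow_range_norm_convexProj_smul_sq_div_sq :
    BddBelow (Set.range fun σ : Set.Ioi (0 : ℝ) =>
      ‖convexProj K ((σ : ℝ) • x)‖ ^ 2 / (σ : ℝ) ^ 2) :=
  ⟨0, by rintro _ ⟨σ, rfl⟩; positivity⟩

theorem highNoiseLimit_le {σ : ℝ} (hσ : 0 < σ) :
    highNoiseLimit K x ≤ ‖convexProj K (σ • x)‖ ^ 2 / σ ^ 2 :=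
  ciInf_le (bddBelow_range_norm_convexProj_smul_sq_div_sq x) (⟨σ, hσ⟩ : Set.Ioi (0 : ℝ))

theorem scaledProjRisk_eq_integral (K : Set (EuclideanSpace ℝ (Fin n))) :
    scaledProjRisk K = fun σ =>
      ∫ x, ‖convexProj K (σ • x)‖ ^ 2 / σ ^ 2 ∂stdGaussian (EuclideanSpace ℝ (Fin n)) :=
  funext fun _ => (integral_div _ _).symm

theorem highNoiseLimit_nonneg : 0 ≤ highNoiseLimit K x :=
  Real.iInf_nonneg fun _ => by positivity

namespace NonemptyClosedConvex

theorem tendsto_highNoiseLimit (hK : NonemptyClosedConvex K) :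
    Tendsto (fun σ : ℝ => ‖convexProj K (σ • x)‖ ^ 2 / σ ^ 2) atTop (𝓝 (highNoiseLimit K x)) :=
  tendsto_comp_val_Ioi_atTop.1 <| tendsto_atTop_ciInf
    (fun _ σ => hK.antitoneOn_norm_convexProj_smul_sq_div_sq x (Subtype.prop _) σ.2)
    (bddBelow_range_norm_convexProj_smul_sq_div_sq x)

theorem tendsto_norm_convexProj_smul_div (hK : NonemptyClosedConvex K) :
    Tendsto (fun σ : ℝ => ‖convexProj K (σ • x)‖ / σ) atTop (𝓝 √(highNoiseLimit K x)) := by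
  refine (hK.tendsto_highNoiseLimit x).sqrt.congr' ?_
  filter_upwards [eventually_gt_atTop 0] with σ hσ
  rw [← div_pow, Real.sqrt_sq (by positivity)]

theorem highNoiseLimit_preimage_const_add (hK : NonemptyClosedConvex K) :
    highNoiseLimit ((μ + ·) ⁻¹' K) x = highNoiseLimit K x := by
  have hdiff : Tendsto (fun σ : ℝ =>
      ‖convexProj ((μ + ·) ⁻¹' K) (σ • x)‖ / σ - ‖convexProj K (σ • x)‖ / σ) atTop (𝓝 0) := by
    refine squeeze_zero_norm' ?_ (tendsto_const_nhds.div_atTop tendsto_id : Tendsto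
      (fun σ : ℝ => (‖μ‖ + ‖μ‖) / σ) atTop (𝓝 0))
    filter_upwards [eventually_gt_atTop 0] with σ hσ
    rw [← sub_div, norm_div, Real.norm_of_nonneg hσ.le, Real.norm_eq_abs,
      hK.convexProj_preimage_const_add]
    gcongr
    calc |‖convexProj K (μ + σ • x) - μ‖ - ‖convexProj K (σ • x)‖|
        ≤ ‖convexProj K (μ + σ • x) - convexProj K (σ • x) - μ‖ := by
          rw [sub_right_comm]
          exact abs_norm_sub_norm_le _ _
      _ ≤ ‖convexProj K (μ + σ • x) - convexProj K (σ • x)‖ + ‖μ‖ := norm_sub_le _ _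
      _ ≤ ‖μ‖ + ‖μ‖ := by
          gcongr
          simpa [dist_eq_norm] using hK.lipschitzWith_convexProj.dist_le_mul (μ + σ • x) (σ • x)
  rw [← Real.sqrt_inj (highNoiseLimit_nonneg x) (highNoiseLimit_nonneg x), ← sub_eq_zero]
  exact tendsto_nhds_unique (((hK.preimage_const_add μ).tendsto_norm_convexProj_smul_div x).sub
    (hK.tendsto_norm_convexProj_smul_div x)) hdiff

theorem integrable_norm_convexProj_smul_sq (hK : NonemptyClosedConvex K) (σ : ℝ) :
    Integrable (fun x => ‖convexProj K (σ • x)‖ ^ 2) (stdGaussian (EuclideanSpace ℝ (Fin n))) :=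
  integrable_sq_stdGaussian_of_lipschitzWith (hK.lipschitzWith_norm_convexProj_smul σ)

theorem tendsto_scaledProjRisk_integral_highNoiseLimit (hK : NonemptyClosedConvex K) :
    Tendsto (scaledProjRisk K) atTop
      (𝓝 (∫ x, highNoiseLimit K x ∂stdGaussian (EuclideanSpace ℝ (Fin n)))) := by
  rw [scaledProjRisk_eq_integral]
  refine tendsto_integral_filter_of_dominated_convergence
    (fun x => ‖convexProj K ((1 : ℝ) • x)‖ ^ 2) (Eventually.of_forall fun σ =>
      ((hK.integrable_norm_convexProj_smul_sq σ).div_const _).aestronglyMeasurable) ?_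
    (hK.integrable_norm_convexProj_smul_sq 1) (ae_of_all _ hK.tendsto_highNoiseLimit)
  filter_upwards [eventually_ge_atTop 1] with σ hσ
  refine ae_of_all _ fun x => ?_
  rw [Real.norm_of_nonneg (by positivity)]
  simpa using hK.antitoneOn_norm_convexProj_smul_sq_div_sq x (Set.mem_Ioi.2 one_pos)
    (Set.mem_Ioi.2 (one_pos.trans_le hσ)) hσ

theorem genStatDim_eq_integral (hK : NonemptyClosedConvex K) :
    genStatDim K = ∫ x, highNoiseLimit K x ∂stdGaussian (EuclideanSpace ℝ (Fin n)) :=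
  hK.tendsto_scaledProjRisk_integral_highNoiseLimit.limUnder_eq

theorem tendsto_scaledProjRisk (hK : NonemptyClosedConvex K) :
    Tendsto (scaledProjRisk K) atTop (𝓝 (genStatDim K)) :=
  hK.genStatDim_eq_integral ▸ hK.tendsto_scaledProjRisk_integral_highNoiseLimit

theorem genStatDim_preimage_const_add (hK : NonemptyClosedConvex K) :
    genStatDim ((μ + ·) ⁻¹' K) = genStatDim K := by
  simp only [(hK.preimage_const_add μ).genStatDim_eq_integral, hK.genStatDim_eq_integral,
    hK.highNoiseLimit_preimage_const_add]

end NonemptyClosedConvex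

end HighNoise

section LowNoise

variable {n : ℕ} {K : Set (EuclideanSpace ℝ (Fin n))} {μ : EuclideanSpace ℝ (Fin n)}

theorem smul_sub_mem_tangentConeOf {α : ℝ} (hα : 0 ≤ α) {ν : EuclideanSpace ℝ (Fin n)}
    (hν : ν ∈ K) : α • (ν - μ) ∈ tangentConeOf K μ :=
  subset_closure ⟨α, hα, ν, hν, rfl⟩

theorem smul_mem_tangentConeOf {c : ℝ} (hc : 0 ≤ c) {v : EuclideanSpace ℝ (Fin n)}
    (hv : v ∈ tangentConeOf K μ) : c • v ∈ tangentConeOf K μ := by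
  refine map_mem_closure (continuous_const_smul c) hv ?_
  rintro _ ⟨α, hα, ν, hν, rfl⟩
  exact ⟨c * α, mul_nonneg hc hα, ν, hν, smul_smul _ _ _⟩

theorem convex_tangentConeOf (hK : Convex ℝ K) : Convex ℝ (tangentConeOf K μ) := by
  refine Convex.closure ?_
  rintro _ ⟨α, hα, ν, hν, rfl⟩ _ ⟨β, hβ, ξ, hξ, rfl⟩ a b ha hb -
  obtain ⟨ζ, hζ, hsum⟩ : ∃ ζ ∈ K, (a * α + b * β) • ζ = (a * α) • ν + (b * β) • ξ :=
    hK.exists_mem_add_smul_eq hν hξ (mul_nonneg ha hα) (mul_nonneg hb hβ)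
  refine ⟨a * α + b * β, by positivity, ζ, hζ, ?_⟩
  rw [smul_sub (_ + _), hsum]
  module

variable (μ x : EuclideanSpace ℝ (Fin n))

theorem tangentConeOf_preimage_const_add (K : Set (EuclideanSpace ℝ (Fin n))) :
    tangentConeOf ((μ + ·) ⁻¹' K) 0 = tangentConeOf K μ := by
  unfold tangentConeOf
  congr! 3 with v
  refine exists_congr fun α => and_congr_right fun _ =>
    ⟨fun ⟨ν, hν, hv⟩ => ⟨μ + ν, hν, by simpa using hv⟩,
      fun ⟨ν, hν, hv⟩ => ⟨ν - μ, by simpa using hν, by simpa using hv⟩⟩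

namespace NonemptyClosedConvex

theorem tangentCone (hK : NonemptyClosedConvex K) :
    NonemptyClosedConvex (tangentConeOf K μ) where
  nonempty := hK.nonempty.elim fun _ hν => ⟨_, smul_sub_mem_tangentConeOf zero_le_one hν⟩
  isClosed := isClosed_closure
  convex := convex_tangentConeOf hK.convex

theorem convexProj_tangentConeOf_smul (hK : NonemptyClosedConvex K) {σ : ℝ} (hσ : 0 < σ) :
    convexProj (tangentConeOf K μ) (σ • x) = σ • convexProj (tangentConeOf K μ) x := by
  have hT := hK.tangentCone μ
  refine hT.convexProj_eq_of_isProjOn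
    ⟨smul_mem_tangentConeOf hσ.le (hT.convexProj_mem x), fun q hq => ?_⟩
  have hmin := (hT.isProjOn_convexProj x).2 _ (smul_mem_tangentConeOf (inv_nonneg.2 hσ.le) hq)
  have hq_eq : σ • x - q = σ • (x - σ⁻¹ • q) := by rw [smul_sub, smul_inv_smul₀ hσ.ne']
  rw [hq_eq, ← smul_sub, norm_smul, norm_smul, mul_pow, mul_pow]
  gcongr

theorem highNoiseLimit_tangentConeOf (hK : NonemptyClosedConvex K) :
    highNoiseLimit (tangentConeOf K μ) x = ‖convexProj (tangentConeOf K μ) x‖ ^ 2 := by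
  have hconst : ∀ σ : Set.Ioi (0 : ℝ), ‖convexProj (tangentConeOf K μ) ((σ : ℝ) • x)‖ ^ 2
      / (σ : ℝ) ^ 2 = ‖convexProj (tangentConeOf K μ) x‖ ^ 2 := fun σ => by
    have hσ : (0 : ℝ) < σ := σ.2
    rw [hK.convexProj_tangentConeOf_smul μ x hσ, norm_smul, Real.norm_of_nonneg hσ.le, mul_pow,
      mul_div_cancel_left₀ _ (by positivity)]
  simp only [highNoiseLimit, hconst, ciInf_const]

theorem genStatDim_tangentConeOf (hK : NonemptyClosedConvex K) :
    genStatDim (tangentConeOf K μ)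
      = ∫ x, ‖convexProj (tangentConeOf K μ) x‖ ^ 2 ∂stdGaussian (EuclideanSpace ℝ (Fin n)) := by
  simp only [(hK.tangentCone μ).genStatDim_eq_integral, hK.highNoiseLimit_tangentConeOf]

theorem eventually_norm_sub_inv_smul_convexProj_sq_le (hK : NonemptyClosedConvex K) (h0 : 0 ∈ K)
    {α : ℝ} (hα : 0 ≤ α) {ν : EuclideanSpace ℝ (Fin n)} (hν : ν ∈ K) :
    ∀ᶠ σ : ℝ in 𝓝[>] 0, ‖x - σ⁻¹ • convexProj K (σ • x)‖ ^ 2 ≤ ‖x - α • ν‖ ^ 2 := by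
  have hsmall : ∀ᶠ σ : ℝ in 𝓝 0, σ * α < 1 :=
    (by fun_prop : Continuous fun σ : ℝ => σ * α).tendsto' 0 0 (by simp)
      |>.eventually_lt_const one_pos
  filter_upwards [hsmall.filter_mono nhdsWithin_le_nhds, self_mem_nhdsWithin] with σ hσα hσ
  have hσ : 0 < σ := hσ
  have hmem : (σ * α) • ν ∈ K := hK.convex.smul_mem_of_zero_mem h0 hν ⟨by positivity, hσα.le⟩
  have hmin := (hK.isProjOn_convexProj (σ • x)).2 _ hmem
  have hscale : ∀ w, ‖σ • x - σ • w‖ ^ 2 = σ ^ 2 * ‖x - w‖ ^ 2 := fun w => by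
    rw [← smul_sub, norm_smul, Real.norm_of_nonneg hσ.le, mul_pow]
  rw [← smul_inv_smul₀ hσ.ne' (convexProj K (σ • x)), mul_smul, hscale, hscale] at hmin
  exact le_of_mul_le_mul_left hmin (by positivity)

theorem norm_inv_smul_convexProj_sub_sq_add_le (hK : NonemptyClosedConvex K) {σ : ℝ}
    (hσ : 0 < σ) :
    ‖x - convexProj (tangentConeOf K 0) x‖ ^ 2
        + ‖σ⁻¹ • convexProj K (σ • x) - convexProj (tangentConeOf K 0) x‖ ^ 2
      ≤ ‖x - σ⁻¹ • convexProj K (σ • x)‖ ^ 2 := by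
  have hmem := smul_sub_mem_tangentConeOf (μ := 0) (inv_nonneg.2 hσ.le)
    (hK.convexProj_mem (σ • x))
  rw [sub_zero] at hmem
  exact (hK.tangentCone 0).norm_sub_convexProj_sq_add_le x hmem

theorem tendsto_inv_smul_convexProj_smul (hK : NonemptyClosedConvex K) (h0 : 0 ∈ K) :
    Tendsto (fun σ : ℝ => σ⁻¹ • convexProj K (σ • x)) (𝓝[>] 0)
      (𝓝 (convexProj (tangentConeOf K 0) x)) := by
  set z := convexProj (tangentConeOf K 0) x
  have hz : z ∈ tangentConeOf K 0 := (hK.tangentCone 0).convexProj_mem x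
  have hsq : Tendsto (fun σ : ℝ => ‖σ⁻¹ • convexProj K (σ • x) - z‖ ^ 2) (𝓝[>] 0) (𝓝 0) := by
    refine tendsto_order.2 ⟨fun a ha => Eventually.of_forall fun σ => ha.trans_le (sq_nonneg _),
      fun ε hε => ?_⟩
    have hcont : Tendsto (fun w => ‖x - w‖ ^ 2 - ‖x - z‖ ^ 2) (𝓝 z) (𝓝 0) :=
      Continuous.tendsto' (by fun_prop) _ _ (sub_self _)
    obtain ⟨_, ⟨α, hα, ν, hν, rfl⟩, hw⟩ :=
      ((mem_closure_iff_frequently.1 hz).and_eventually (hcont.eventually_lt_const hε)).exists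
    rw [sub_zero] at hw
    filter_upwards [hK.eventually_norm_sub_inv_smul_convexProj_sq_le x h0 hα hν,
      self_mem_nhdsWithin] with σ hle hσ
    linarith [hK.norm_inv_smul_convexProj_sub_sq_add_le x hσ]
  rw [tendsto_iff_norm_sub_tendsto_zero]
  simpa using hsq.sqrt

theorem tendsto_norm_convexProj_smul_sq_div_sq (hK : NonemptyClosedConvex K) (h0 : 0 ∈ K) :
    Tendsto (fun σ : ℝ => ‖convexProj K (σ • x)‖ ^ 2 / σ ^ 2) (𝓝[>] 0)
      (𝓝 (‖convexProj (tangentConeOf K 0) x‖ ^ 2)) := by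
  refine ((hK.tendsto_inv_smul_convexProj_smul x h0).norm.pow 2).congr fun σ => ?_
  rw [norm_smul, norm_inv, inv_mul_eq_div, div_pow, Real.norm_eq_abs, sq_abs]

theorem tendsto_scaledProjRisk_nhdsGT_zero (hK : NonemptyClosedConvex K) (h0 : 0 ∈ K) :
    Tendsto (scaledProjRisk K) (𝓝[>] 0) (𝓝 (genStatDim (tangentConeOf K 0))) := by
  rw [hK.genStatDim_tangentConeOf, scaledProjRisk_eq_integral]
  refine tendsto_integral_filter_of_dominated_convergence (fun x => ‖x‖ ^ 2)
    (Eventually.of_forall fun σ =>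
      ((hK.integrable_norm_convexProj_smul_sq σ).div_const _).aestronglyMeasurable) ?_
    (integrable_sq_stdGaussian_of_lipschitzWith lipschitzWith_one_norm)
    (ae_of_all _ fun x => hK.tendsto_norm_convexProj_smul_sq_div_sq x h0)
  filter_upwards [self_mem_nhdsWithin] with σ hσ
  refine ae_of_all _ fun x => ?_
  rw [Real.norm_of_nonneg (by positivity)]
  exact hK.norm_convexProj_smul_sq_div_sq_le x h0 hσ

theorem genStatDim_le_genStatDim_tangentConeOf_zero (hK : NonemptyClosedConvex K) (h0 : 0 ∈ K) :
    genStatDim K ≤ genStatDim (tangentConeOf K 0) := by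
  rw [hK.genStatDim_eq_integral, hK.genStatDim_tangentConeOf]
  refine integral_mono_of_nonneg (ae_of_all _ highNoiseLimit_nonneg)
    (integrable_sq_stdGaussian_of_lipschitzWith
      (lipschitzWith_one_norm.comp (hK.tangentCone 0).lipschitzWith_convexProj))
    (ae_of_all _ fun x => ge_of_tendsto (hK.tendsto_norm_convexProj_smul_sq_div_sq x h0) ?_)
  filter_upwards [self_mem_nhdsWithin] with σ hσ
  exact highNoiseLimit_le x hσ

end NonemptyClosedConvex

end LowNoise

section Estimator

variable {n : ℕ} {K : Set (EuclideanSpace ℝ (Fin n))} (μ x : EuclideanSpace ℝ (Fin n))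

namespace NonemptyClosedConvex

theorem seqErr_eq (hK : NonemptyClosedConvex K) (σ : ℝ) :
    seqErr K μ σ x = ‖convexProj ((μ + ·) ⁻¹' K) (σ • x)‖ ^ 2 := by
  rw [seqErr, seqLSE, hK.convexProj_preimage_const_add]

theorem lipschitzWith_norm_seqLSE_sub (hK : NonemptyClosedConvex K) (σ : ℝ) :
    LipschitzWith ‖σ‖₊ fun x => ‖seqLSE K μ σ x - μ‖ := by
  simpa only [seqLSE, hK.convexProj_preimage_const_add]
    using (hK.preimage_const_add μ).lipschitzWith_norm_convexProj_smul σ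

theorem tendsto_seqErr_div_sq (hK : NonemptyClosedConvex K) :
    Tendsto (fun σ : ℝ => seqErr K μ σ x / σ ^ 2) atTop (𝓝 (highNoiseLimit K x)) := by
  simpa only [hK.seqErr_eq, hK.highNoiseLimit_preimage_const_add]
    using (hK.preimage_const_add μ).tendsto_highNoiseLimit x

theorem highNoiseLimit_le_seqErr_div_sq (hK : NonemptyClosedConvex K) {σ : ℝ} (hσ : 0 < σ) :
    highNoiseLimit K x ≤ seqErr K μ σ x / σ ^ 2 := by
  simpa only [hK.seqErr_eq, hK.highNoiseLimit_preimage_const_add]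
    using highNoiseLimit_le (K := (μ + ·) ⁻¹' K) x hσ

theorem seqErr_div_sq_le (hK : NonemptyClosedConvex K) (hμ : μ ∈ K) {σ : ℝ} (hσ : 0 < σ) :
    seqErr K μ σ x / σ ^ 2 ≤ ‖x‖ ^ 2 := by
  simpa only [hK.seqErr_eq]
    using (hK.preimage_const_add μ).norm_convexProj_smul_sq_div_sq_le x (by simpa using hμ) hσ

variable {Ω : Type*} [MeasurableSpace Ω] {P : Measure Ω} {h : Ω → EuclideanSpace ℝ (Fin n)}

theorem integral_seqErr_eq (hK : NonemptyClosedConvex K) (σ : ℝ)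
    (hh : HasLaw h (stdGaussian (EuclideanSpace ℝ (Fin n))) P) :
    ∫ ω, seqErr K μ σ (h ω) ∂P
      = ∫ x, seqErr K μ σ x ∂stdGaussian (EuclideanSpace ℝ (Fin n)) :=
  hh.integral_comp
    ((hK.lipschitzWith_norm_seqLSE_sub μ σ).continuous.pow 2).aestronglyMeasurable

theorem integral_seqErr_div_sq (hK : NonemptyClosedConvex K)
    (hh : HasLaw h (stdGaussian (EuclideanSpace ℝ (Fin n))) P) (σ : ℝ) :
    (∫ ω, seqErr K μ σ (h ω) ∂P) / σ ^ 2 = scaledProjRisk ((μ + ·) ⁻¹' K) σ := by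
  rw [hK.integral_seqErr_eq μ σ hh, scaledProjRisk]
  simp only [hK.seqErr_eq]

theorem tendsto_integral_seqErr_div_sq_atTop (hK : NonemptyClosedConvex K)
    (hh : HasLaw h (stdGaussian (EuclideanSpace ℝ (Fin n))) P) :
    Tendsto (fun σ : ℝ => (∫ ω, seqErr K μ σ (h ω) ∂P) / σ ^ 2) atTop (𝓝 (genStatDim K)) := by
  simpa only [hK.integral_seqErr_div_sq μ hh, hK.genStatDim_preimage_const_add]
    using (hK.preimage_const_add μ).tendsto_scaledProjRisk

theorem tendsto_integral_seqErr_div_sq_nhdsGT_zero (hK : NonemptyClosedConvex K) (hμ : μ ∈ K)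
    (hh : HasLaw h (stdGaussian (EuclideanSpace ℝ (Fin n))) P) :
    Tendsto (fun σ : ℝ => (∫ ω, seqErr K μ σ (h ω) ∂P) / σ ^ 2) (𝓝[>] 0)
      (𝓝 (genStatDim (tangentConeOf K μ))) := by
  simpa only [hK.integral_seqErr_div_sq μ hh, tangentConeOf_preimage_const_add]
    using (hK.preimage_const_add μ).tendsto_scaledProjRisk_nhdsGT_zero (by simpa using hμ)

theorem genStatDim_le_genStatDim_tangentConeOf (hK : NonemptyClosedConvex K) (hμ : μ ∈ K) :
    genStatDim K ≤ genStatDim (tangentConeOf K μ) := by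
  simpa only [hK.genStatDim_preimage_const_add, tangentConeOf_preimage_const_add]
    using (hK.preimage_const_add μ).genStatDim_le_genStatDim_tangentConeOf_zero
      (by simpa using hμ)

theorem hasSubgammaMGF_seqErr_sub_integral (hK : NonemptyClosedConvex K) (σ : ℝ)
    (hh : HasLaw h (stdGaussian (EuclideanSpace ℝ (Fin n))) P) :
    HasSubgammaMGF (fun ω => seqErr K μ σ (h ω) - ∫ ω', seqErr K μ σ (h ω') ∂P)
      (4 * σ ^ 2 * ∫ ω, seqErr K μ σ (h ω) ∂P) (2 * σ ^ 2) P := by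
  have hsub := hasSubgammaMGF_sq_sub_integral_of_lipschitzWith
    (hK.lipschitzWith_norm_seqLSE_sub μ σ)
  rw [coe_nnnorm, Real.norm_eq_abs, sq_abs] at hsub
  simp only [hK.integral_seqErr_eq μ σ hh]
  exact hsub.comp_hasLaw hh

end NonemptyClosedConvex

end Estimator

theorem proposition4p3 {n : ℕ} (K : Set (EuclideanSpace ℝ (Fin n))) (hKne : K.Nonempty)
    (hKcl : IsClosed K) (hKcv : Convex ℝ K) (μ₀ : EuclideanSpace ℝ (Fin n))
    {Ω : Type*} [MeasurableSpace Ω] (P : Measure Ω) [IsProbabilityMeasure P]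
    (h : Ω → EuclideanSpace ℝ (Fin n))
    (hh : HasLaw h (stdGaussian (EuclideanSpace ℝ (Fin n))) P) :
    -- (1), for a signal `μ₀ ∈ K`
    (μ₀ ∈ K →
      -- pathwise: the high-noise limit exists, bounds `err(σ)/σ²` below, and is attained at `∞`
      (∀ x : EuclideanSpace ℝ (Fin n), ∃ l : ℝ,
        Tendsto (fun σ : ℝ => ‖convexProj K (σ • x)‖ ^ 2 / σ ^ 2) atTop (𝓝 l) ∧
        (∀ σ : ℝ, 0 < σ → l ≤ seqErr K μ₀ σ x / σ ^ 2 ∧ seqErr K μ₀ σ x / σ ^ 2 ≤ ‖x‖ ^ 2) ∧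
        Tendsto (fun σ : ℝ => seqErr K μ₀ σ x / σ ^ 2) atTop (𝓝 l)) ∧
      -- the limits that define `δ_K` and `δ_{T_K(μ₀)}` are genuine
      (∀ σ : ℝ, 0 < σ → Integrable (fun x => ‖convexProj K (σ • x)‖ ^ 2)
        (stdGaussian (EuclideanSpace ℝ (Fin n)))) ∧
      Tendsto (scaledProjRisk K) atTop (𝓝 (genStatDim K)) ∧
      (∀ σ : ℝ, 0 < σ → Integrable (fun x => ‖convexProj (tangentConeOf K μ₀) (σ • x)‖ ^ 2)
        (stdGaussian (EuclideanSpace ℝ (Fin n)))) ∧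
      Tendsto (scaledProjRisk (tangentConeOf K μ₀)) atTop
        (𝓝 (genStatDim (tangentConeOf K μ₀))) ∧
      -- the high- and low-noise limits of the normalized risk
      Tendsto (fun σ : ℝ => (∫ ω, seqErr K μ₀ σ (h ω) ∂P) / σ ^ 2) atTop (𝓝 (genStatDim K)) ∧
      Tendsto (fun σ : ℝ => (∫ ω, seqErr K μ₀ σ (h ω) ∂P) / σ ^ 2) (𝓝[>] 0)
        (𝓝 (genStatDim (tangentConeOf K μ₀))) ∧
      genStatDim K ≤ genStatDim (tangentConeOf K μ₀)) ∧
    -- (2) the variance bound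
    (∀ σ : ℝ, 0 < σ →
      MemLp (fun ω => seqErr K μ₀ σ (h ω)) 2 P ∧
      variance (fun ω => seqErr K μ₀ σ (h ω)) P
        ≤ 4 * σ ^ 2 * ∫ ω, seqErr K μ₀ σ (h ω) ∂P) ∧
    -- (3) the moment generating function bound and the tail bound
    (∀ σ : ℝ, 0 < σ →
      (∀ lam : ℝ, lam < 1 / (2 * σ ^ 2) →
        Integrable (fun ω => Real.exp (lam *
          (seqErr K μ₀ σ (h ω) - ∫ ω', seqErr K μ₀ σ (h ω') ∂P))) P ∧
        ∫ ω, Real.exp (lam * (seqErr K μ₀ σ (h ω) - ∫ ω', seqErr K μ₀ σ (h ω') ∂P)) ∂P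
          ≤ Real.exp (2 * σ ^ 2 * lam ^ 2 * (∫ ω, seqErr K μ₀ σ (h ω) ∂P)
              / (1 - 2 * σ ^ 2 * lam))) ∧
      (∀ t : ℝ, 0 ≤ t →
        P.real {ω | Real.sqrt (8 * σ ^ 2 * (∫ ω', seqErr K μ₀ σ (h ω') ∂P) * t) + 2 * σ ^ 2 * t
            ≤ |seqErr K μ₀ σ (h ω) - ∫ ω', seqErr K μ₀ σ (h ω') ∂P|}
          ≤ 2 * Real.exp (-t))) := by
  have hK : NonemptyClosedConvex K := ⟨hKne, hKcl, hKcv⟩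
  have hT := hK.tangentCone μ₀
  have hsub := fun σ => hK.hasSubgammaMGF_seqErr_sub_integral μ₀ σ hh
  refine ⟨fun hμ₀ => ?_, fun σ _ => ⟨(hsub σ).memLp_two_of_sub_const, (hsub σ).variance_le⟩,
    fun σ hσ => ⟨fun lam hlam => ?_, fun t ht => ?_⟩⟩
  · exact ⟨fun x => ⟨highNoiseLimit K x, hK.tendsto_highNoiseLimit x,
        fun σ hσ => ⟨hK.highNoiseLimit_le_seqErr_div_sq μ₀ x hσ, hK.seqErr_div_sq_le μ₀ x hμ₀ hσ⟩,
        hK.tendsto_seqErr_div_sq μ₀ x⟩,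
      fun σ _ => hK.integrable_norm_convexProj_smul_sq σ, hK.tendsto_scaledProjRisk,
      fun σ _ => hT.integrable_norm_convexProj_smul_sq σ, hT.tendsto_scaledProjRisk,
      hK.tendsto_integral_seqErr_div_sq_atTop μ₀ hh,
      hK.tendsto_integral_seqErr_div_sq_nhdsGT_zero μ₀ hμ₀ hh,
      hK.genStatDim_le_genStatDim_tangentConeOf μ₀ hμ₀⟩
  · have hscaled : 2 * σ ^ 2 * lam < 1 := by
      rwa [lt_div_iff₀' (by positivity)] at hlam
    refine ⟨(hsub σ).integrable_exp_mul lam hscaled,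
      ((hsub σ).mgf_le lam hscaled).trans_eq (congrArg Real.exp ?_)⟩
    rw [← mul_div_mul_left (2 * σ ^ 2 * _ * _) _ (two_ne_zero' ℝ)]
    congr 1
    ring
  · convert (hsub σ).measureReal_abs_ge_le_two_mul_exp (by positivity) ht using 7
    ring
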